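/- Equip $\mathbb{C}^3$ with the Hermitian form $\langle z,w\rangle = z_1\overline{w_3}+z_2\overline{w_2}+z_3\overline{w_1}$ of signature $(2,1)$, and let $\overline{\mathbb{H}^2_{\mathbb{C}}}=\{[z]\in\mathbb{CP}^2 \mid \langle z,z\rangle\le 0\}$ be the complex hyperbolic plane together with its boundary at infinity. For $\alpha_2\in\mathbb{R}$ let $$S=\begin{pmatrix}1&\sqrt2e^{-i\alpha_2}&-1\\-\sqrt2e^{i\alpha_2}&-1&0\\-1&0&0\end{pmatrix},\quad T=\begin{pmatrix}0&0&-1\\0&-1&-\sqrt2e^{-i\alpha_2}\\-1&\sqrt2e^{i\alpha_2}&1\end{pmatrix},\quad U=S^{-1}T,$$ $$p_U=\begin{pmatrix}1\\-\frac{\sqrt2}{2}e^{i\alpha_2}\\e^{2i\alpha_2}\end{pmatrix},\quad p_V=Sp_U,\quad p_W=S^2p_U,\quad p_A=\begin{pmatrix}1\\0\\0\end{pmatrix},\quad p_B=\begin{pmatrix}0\\0\\1\end{pmatrix}$$ (so that $Up_U=p_U$, while $p_A$ and $p_B$ are fixed by $ST$ and $TS$ respectively). For $k\in\mathbb{Z}$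 let $$\mathcal{J}_k^-=\{[z]\in\overline{\mathbb{H}^2_{\mathbb{C}}} \mid |\langle z,p_U\rangle|=|\langle z,U^kp_W\rangle|\},$$ $$\mathcal{F}_k^-=\{[z]\in\mathcal{J}_k^- \mid |\langle z,p_U\rangle|\le\min(|\langle z,U^kp_V\rangle|,|\langle z,U^{k+1}p_V\rangle|)\}.$$ Then, for every $\alpha_2\in\,]0,\frac{\pi}{2}[$, $$\mathcal{F}_0^-\cap\mathcal{F}_{-1}^-=\{[p_A],[p_B]\}.$$ -/

import Mathlib

open scoped LinearAlgebra.Projectivization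

noncomputable section

namespace FordDeformation

/-- The complex projective plane `ℂP²`. -/
abbrev CP2 : Type := ℙ ℂ (Fin 3 → ℂ)

/-- The Hermitian form of signature `(2,1)` on `ℂ³` defining the Siegel model:
`⟨z, w⟩ = z₁ w̄₃ + z₂ w̄₂ + z₃ w̄₁`. -/
def herm (z w : Fin 3 → ℂ) : ℂ :=
  z 0 * (starRingEnd ℂ) (w 2) + z 1 * (starRingEnd ℂ) (w 1) + z 2 * (starRingEnd ℂ) (w 0)

theorem herm_smul_left (c : ℂ) (z w : Fin 3 → ℂ) : herm (c • z) w = c * herm z w := by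
  simp only [herm, Pi.smul_apply, smul_eq_mul]; ring

theorem herm_smul_smul (c : ℂ) (z : Fin 3 → ℂ) :
    (herm (c • z) (c • z)).re = ‖c‖ ^ 2 * (herm z z).re := by
  have h : herm (c • z) (c • z) = (Complex.normSq c : ℂ) * herm z z := by
    rw [← Complex.mul_conj]
    simp only [herm, Pi.smul_apply, smul_eq_mul, map_mul]; ring
  rw [h, Complex.re_ofReal_mul, Complex.normSq_eq_norm_sq]

/-- The closure in `ℂP²` of the complex hyperbolic plane, i.e. complex hyperbolic plane together
with its boundary at infinity: the points `[z]` with `⟨z, z⟩ ≤ 0`. -/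
def closedH2C : Set CP2 := {x | (herm x.rep x.rep).re ≤ 0}

/-- The bisector `𝔅(p, q)` (in the closure of the complex hyperbolic plane): the points `[z]` with
`⟨z, z⟩ ≤ 0` and `|⟨z, p⟩| = |⟨z, q⟩|`. -/
def bisector (p q : Fin 3 → ℂ) : Set CP2 :=
  {x | x ∈ closedH2C ∧ ‖herm x.rep p‖ = ‖herm x.rep q‖}

/-- The order three generator `S` of the representation with parameter `α₂`. -/
def matS (α₂ : ℝ) : Matrix (Fin 3) (Fin 3) ℂ :=
  !![1, (√2 : ℝ) * Complex.exp (-(Complex.I * α₂)), -1;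
     -((√2 : ℝ) * Complex.exp (Complex.I * α₂)), -1, 0;
     -1, 0, 0]

/-- The order three generator `T` of the representation with parameter `α₂`. -/
def matT (α₂ : ℝ) : Matrix (Fin 3) (Fin 3) ℂ :=
  !![0, 0, -1;
     0, -1, -((√2 : ℝ) * Complex.exp (-(Complex.I * α₂)));
     -1, (√2 : ℝ) * Complex.exp (Complex.I * α₂), 1]

/-- `U = S⁻¹ T`. -/
def matU (α₂ : ℝ) : Matrix (Fin 3) (Fin 3) ℂ := (matS α₂)⁻¹ * matT α₂

/-- The fixed vector `p_U` of `U`. -/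
def vecU (α₂ : ℝ) : Fin 3 → ℂ :=
  ![1, -((√2 / 2 : ℝ) * Complex.exp (Complex.I * α₂)), Complex.exp (2 * Complex.I * α₂)]

/-- `p_V = S p_U`. -/
def vecV (α₂ : ℝ) : Fin 3 → ℂ := Matrix.mulVec (matS α₂) (vecU α₂)

/-- `p_W = S² p_U`. -/
def vecW (α₂ : ℝ) : Fin 3 → ℂ := Matrix.mulVec (matS α₂ ^ 2) (vecU α₂)

/-- `U^k p`, for `k ∈ ℤ`. -/
def powU (α₂ : ℝ) (k : ℤ) (p : Fin 3 → ℂ) : Fin 3 → ℂ := Matrix.mulVec (matU α₂ ^ k) p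

/-- The bisector `𝒥_k⁻ = 𝔅(p_U, U^k p_W)`. -/
def bisectorMinus (α₂ : ℝ) (k : ℤ) : Set CP2 := bisector (vecU α₂) (powU α₂ k (vecW α₂))

/-- The 3-face `ℱ_k⁻`: the points `[z]` of `𝒥_k⁻` with
`|⟨z, p_U⟩| ≤ min (|⟨z, U^k p_V⟩|, |⟨z, U^(k+1) p_V⟩|)`. -/
def faceMinus (α₂ : ℝ) (k : ℤ) : Set CP2 :=
  {x | x ∈ bisectorMinus α₂ k ∧
    ‖herm x.rep (vecU α₂)‖ ≤
      min ‖herm x.rep (powU α₂ k (vecV α₂))‖ ‖herm x.rep (powU α₂ (k + 1) (vecV α₂))‖}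

/-- The point `[p_A] = [1 : 0 : 0]`, fixed by `S T`. -/
def pointA : CP2 :=
  Projectivization.mk ℂ ![1, 0, 0] (fun h => one_ne_zero (α := ℂ) (by simpa using congrFun h 0))

/-- The point `[p_B] = [0 : 0 : 1]`, fixed by `T S`. -/
def pointB : CP2 :=
  Projectivization.mk ℂ ![0, 0, 1] (fun h => one_ne_zero (α := ℂ) (by simpa using congrFun h 2))

/-! The sets above do not depend on the chosen representatives. -/

theorem mk_mem_closedH2C (z : Fin 3 → ℂ) (hz : z ≠ 0) :
    Projectivization.mk ℂ z hz ∈ closedH2C ↔ (herm z z).re ≤ 0 := by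
  obtain ⟨a, ha⟩ := Projectivization.exists_smul_eq_mk_rep ℂ z hz
  have hpos : 0 < ‖(a : ℂ)‖ ^ 2 := by
    have := norm_pos_iff.mpr a.ne_zero
    positivity
  change (herm (Projectivization.mk ℂ z hz).rep (Projectivization.mk ℂ z hz).rep).re ≤ 0 ↔ _
  rw [← ha, Units.smul_def, herm_smul_smul, ← not_lt, ← not_lt, mul_pos_iff_of_pos_left hpos]

theorem mk_mem_bisector (p q z : Fin 3 → ℂ) (hz : z ≠ 0) :
    Projectivization.mk ℂ z hz ∈ bisector p q ↔
      (herm z z).re ≤ 0 ∧ ‖herm z p‖ = ‖herm z q‖ := by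
  obtain ⟨a, ha⟩ := Projectivization.exists_smul_eq_mk_rep ℂ z hz
  have hpos : 0 < ‖(a : ℂ)‖ := norm_pos_iff.mpr a.ne_zero
  change Projectivization.mk ℂ z hz ∈ closedH2C ∧
    ‖herm (Projectivization.mk ℂ z hz).rep p‖ = ‖herm (Projectivization.mk ℂ z hz).rep q‖ ↔ _
  rw [mk_mem_closedH2C, ← ha, Units.smul_def, herm_smul_left, herm_smul_left, norm_mul, norm_mul,
    mul_right_inj' hpos.ne']

theorem mk_mem_faceMinus (α₂ : ℝ) (k : ℤ) (z : Fin 3 → ℂ) (hz : z ≠ 0) :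
    Projectivization.mk ℂ z hz ∈ faceMinus α₂ k ↔
      ((herm z z).re ≤ 0 ∧ ‖herm z (vecU α₂)‖ = ‖herm z (powU α₂ k (vecW α₂))‖) ∧
        ‖herm z (vecU α₂)‖ ≤
          min ‖herm z (powU α₂ k (vecV α₂))‖ ‖herm z (powU α₂ (k + 1) (vecV α₂))‖ := by
  obtain ⟨a, ha⟩ := Projectivization.exists_smul_eq_mk_rep ℂ z hz
  have hpos : 0 < ‖(a : ℂ)‖ := norm_pos_iff.mpr a.ne_zero
  rw [← mk_mem_bisector _ _ z hz]
  change _ ∧ ‖herm (Projectivization.mk ℂ z hz).rep _‖ ≤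
    min ‖herm (Projectivization.mk ℂ z hz).rep _‖ ‖herm (Projectivization.mk ℂ z hz).rep _‖ ↔ _
  rw [← ha, Units.smul_def, herm_smul_left, herm_smul_left, herm_smul_left, norm_mul, norm_mul,
    norm_mul, ← mul_min_of_nonneg _ _ hpos.le, mul_le_mul_iff_right₀ hpos]
  rfl

end FordDeformation

end

namespace FordDeformation

open Complex

/-! Explicit coordinates, in terms of `a = exp (i α₂)` and its conjugate. -/

/-! Write c, s for the cosine and sine of α. Points of nonpositive type can be scaled so that z₁ -
z₃ = 1; put z₁ + z₃ = P = p + iq and (√2/2) z₂ = w = u + it. Up to unit factors the products with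
p_U, p_V, p_W, U⁻¹p_W are then cP - is - w, cP + is + w, 1 + w(3c - is), 1 - w(3c + is). The two
bisector equations differ by 12cu, so u = 0. The remaining equation is a vanishing sum of three
terms that are nonnegative by ⟨z,z⟩ ≤ 0, by |⟨z,p_U⟩| ≤ |⟨z,p_V⟩| and as a square
(`eq_zero_of_normalised`). Hence w = 0, q = 0 and p = ±1, which are p_A and p_B; `normalised_rep_eq`
assembles this. The vectors U^{±1}p_V matter only for the converse inclusion. -/

/-- The unit complex number `exp (i α)`. -/
noncomputable def unitExp (α : ℝ) : ℂ := Complex.exp (Complex.I * α)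

theorem unitExp_eq (α : ℝ) : unitExp α = Real.cos α + Real.sin α * I := by
  rw [unitExp, mul_comm, Complex.exp_mul_I, Complex.ofReal_cos, Complex.ofReal_sin]

theorem conj_unitExp (α : ℝ) : (starRingEnd ℂ) (unitExp α) = Complex.exp (-(Complex.I * α)) := by
  rw [unitExp, ← Complex.exp_conj]
  simp

theorem unitExp_mul_conj (α : ℝ) : unitExp α * (starRingEnd ℂ) (unitExp α) = 1 := by
  rw [conj_unitExp, unitExp, ← Complex.exp_add]
  simp

theorem norm_unitExp (α : ℝ) : ‖unitExp α‖ = 1 := by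
  rw [unitExp, mul_comm, Complex.norm_exp_ofReal_mul_I]

theorem ofReal_sqrt_two_sq : ((√2 : ℝ) : ℂ) ^ 2 = 2 := by
  rw [← Complex.ofReal_pow, Real.sq_sqrt (by norm_num)]
  simp

theorem matS_eq (α : ℝ) : matS α =
    !![1, (√2 : ℝ) * (starRingEnd ℂ) (unitExp α), -1;
      -((√2 : ℝ) * unitExp α), -1, 0; -1, 0, 0] := by
  rw [conj_unitExp]; rfl

theorem matT_eq (α : ℝ) : matT α =
    !![0, 0, -1; 0, -1, -((√2 : ℝ) * (starRingEnd ℂ) (unitExp α));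
      -1, (√2 : ℝ) * unitExp α, 1] := by
  rw [conj_unitExp]; rfl

theorem vecU_eq (α : ℝ) : vecU α =
    ![1, -((√2 : ℝ) * unitExp α / 2), unitExp α ^ 2] := by
  have h : Complex.exp (2 * Complex.I * α) = unitExp α ^ 2 := by
    rw [unitExp, ← Complex.exp_nat_mul]; congr 1; push_cast; ring
  rw [vecU, h]
  ext i
  fin_cases i <;> simp [unitExp]
  ring

theorem matS_sq (α : ℝ) : matS α ^ 2 =
    !![0, 0, -1; 0, -1, (√2 : ℝ) * unitExp α;
      -1, -((√2 : ℝ) * (starRingEnd ℂ) (unitExp α)), 1] := by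
  have h := unitExp_mul_conj α
  have h2 := ofReal_sqrt_two_sq
  rw [matS_eq, pow_two]
  generalize (starRingEnd ℂ) (unitExp α) = b at *
  generalize unitExp α = a at *
  generalize ((√2 : ℝ) : ℂ) = r at *
  ext i j
  fin_cases i <;> fin_cases j <;> simp [Matrix.mul_apply, Fin.sum_univ_three]
  · linear_combination (-r ^ 2) * h - h2
  · linear_combination (-r ^ 2) * h - h2

theorem matT_sq (α : ℝ) : matT α ^ 2 =
    !![1, -((√2 : ℝ) * unitExp α), -1;
      (√2 : ℝ) * (starRingEnd ℂ) (unitExp α), -1, 0; -1, 0, 0] := by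
  have h := unitExp_mul_conj α
  have h2 := ofReal_sqrt_two_sq
  rw [matT_eq, pow_two]
  generalize (starRingEnd ℂ) (unitExp α) = b at *
  generalize unitExp α = a at *
  generalize ((√2 : ℝ) : ℂ) = r at *
  ext i j
  fin_cases i <;> fin_cases j <;> simp [Matrix.mul_apply, Fin.sum_univ_three]
  · linear_combination (-r ^ 2) * h - h2
  · linear_combination (-r ^ 2) * h - h2

theorem matS_pow_three (α : ℝ) : matS α ^ 3 = 1 := by
  have h := unitExp_mul_conj α
  have h2 := ofReal_sqrt_two_sq
  rw [pow_succ, matS_sq, matS_eq]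
  generalize (starRingEnd ℂ) (unitExp α) = b at *
  generalize unitExp α = a at *
  generalize ((√2 : ℝ) : ℂ) = r at *
  ext i j
  fin_cases i <;> fin_cases j <;> simp [Matrix.mul_apply, Fin.sum_univ_three]
  linear_combination r ^ 2 * h + h2

theorem matT_pow_three (α : ℝ) : matT α ^ 3 = 1 := by
  have h := unitExp_mul_conj α
  have h2 := ofReal_sqrt_two_sq
  rw [pow_succ, matT_sq, matT_eq]
  generalize (starRingEnd ℂ) (unitExp α) = b at *
  generalize unitExp α = a at *
  generalize ((√2 : ℝ) : ℂ) = r at *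
  ext i j
  fin_cases i <;> fin_cases j <;> simp [Matrix.mul_apply, Fin.sum_univ_three]
  linear_combination r ^ 2 * h + h2

/-- Since S and T have order three, squares replace inverses here and in `matU_inv`. -/
theorem matU_eq (α : ℝ) : matU α = matS α ^ 2 * matT α := by
  rw [matU, Matrix.inv_eq_right_inv (B := matS α ^ 2)]
  rw [← pow_succ', matS_pow_three]

theorem matU_inv (α : ℝ) : (matU α)⁻¹ = matT α ^ 2 * matS α := by
  apply Matrix.inv_eq_right_inv
  rw [matU_eq, mul_assoc, ← mul_assoc (matT α), ← pow_succ', matT_pow_three, one_mul, ← pow_succ,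
    matS_pow_three]

theorem vecV_eq (α : ℝ) : vecV α =
    ![-unitExp α ^ 2, -((√2 : ℝ) * unitExp α / 2), -1] := by
  have h := unitExp_mul_conj α
  have h2 := ofReal_sqrt_two_sq
  rw [vecV, matS_eq, vecU_eq]
  generalize (starRingEnd ℂ) (unitExp α) = b at *
  generalize unitExp α = a at *
  generalize ((√2 : ℝ) : ℂ) = r at *
  ext i
  fin_cases i <;> simp [Matrix.mulVec, dotProduct, Fin.sum_univ_three]
  · linear_combination (-r ^ 2 / 2) * h - h2 / 2
  · ring

theorem vecW_eq (α : ℝ) : vecW α =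
    ![-unitExp α ^ 2, (√2 : ℝ) * unitExp α ^ 3 + (√2 : ℝ) * unitExp α / 2, unitExp α ^ 2] := by
  have h := unitExp_mul_conj α
  have h2 := ofReal_sqrt_two_sq
  rw [vecW, matS_sq, vecU_eq]
  generalize (starRingEnd ℂ) (unitExp α) = b at *
  generalize unitExp α = a at *
  generalize ((√2 : ℝ) : ℂ) = r at *
  ext i
  fin_cases i <;> simp [Matrix.mulVec, dotProduct, Fin.sum_univ_three]
  · ring
  · linear_combination (r ^ 2 / 2) * h + h2 / 2

theorem powU_zero (α : ℝ) (p : Fin 3 → ℂ) : powU α 0 p = p := by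
  simp [powU]

/-- `U⁻¹ p_W = T² p_U`. -/
theorem powU_neg_one_vecW (α : ℝ) : powU α (-1) (vecW α) =
    ![1, (√2 : ℝ) * unitExp α / 2 + (√2 : ℝ) * (starRingEnd ℂ) (unitExp α), -1] := by
  have h := unitExp_mul_conj α
  have h2 := ofReal_sqrt_two_sq
  rw [powU, zpow_neg_one, matU_inv, vecW, Matrix.mulVec_mulVec, mul_assoc, ← pow_succ',
    matS_pow_three, mul_one, matT_sq, vecU_eq]
  generalize (starRingEnd ℂ) (unitExp α) = b at *
  generalize unitExp α = a at *
  generalize ((√2 : ℝ) : ℂ) = r at *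
  ext i
  fin_cases i <;> simp [Matrix.mulVec, dotProduct, Fin.sum_univ_three]
  · linear_combination (a ^ 2 / 2) * h2
  · ring

/-- The middle coordinate is left unnamed: this vector is only paired with p_A and p_B, whose middle
coordinate is 0. -/
theorem powU_one_vecV (α : ℝ) : ∃ m : ℂ, powU α 1 (vecV α) =
    ![1, m, -(3 + 2 * (starRingEnd ℂ) (unitExp α) ^ 2)] := by
  have h := unitExp_mul_conj α
  have h2 := ofReal_sqrt_two_sq
  refine ⟨powU α 1 (vecV α) 1, ?_⟩
  rw [powU, zpow_one, matU_eq, ← Matrix.mulVec_mulVec, matS_sq, matT_eq, vecV_eq]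
  generalize (starRingEnd ℂ) (unitExp α) = b at *
  generalize unitExp α = a at *
  generalize ((√2 : ℝ) : ℂ) = r at *
  ext i
  fin_cases i <;> simp [Matrix.mulVec, dotProduct, Fin.sum_univ_three]
  · linear_combination (a ^ 2 / 2) * h2
  · linear_combination (-r ^ 2 / 2) * h + (-1 / 2 - a ^ 2 / 2 - b ^ 2) * h2

theorem powU_neg_one_vecV (α : ℝ) : ∃ m : ℂ, powU α (-1) (vecV α) =
    ![-(unitExp α ^ 2 * (3 + 2 * unitExp α ^ 2)), m, unitExp α ^ 2] := by
  have h := unitExp_mul_conj α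
  have h2 := ofReal_sqrt_two_sq
  refine ⟨powU α (-1) (vecV α) 1, ?_⟩
  rw [powU, zpow_neg_one, matU_inv, ← Matrix.mulVec_mulVec, matT_sq, matS_eq, vecV_eq]
  generalize (starRingEnd ℂ) (unitExp α) = b at *
  generalize unitExp α = a at *
  generalize ((√2 : ℝ) : ℂ) = r at *
  ext i
  fin_cases i <;> simp [Matrix.mulVec, dotProduct, Fin.sum_univ_three]
  · linear_combination (-r ^ 2 / 2) * h + (-1 / 2 - a ^ 4 - a ^ 2 / 2) * h2
  · linear_combination (r ^ 2 / 2) * h + h2 / 2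

/-! Norms of the products with the four vectors, up to unit factors. -/

theorem norm_herm_vecU (α : ℝ) (z : Fin 3 → ℂ) : ‖herm z (vecU α)‖ =
    ‖z 0 * (starRingEnd ℂ) (unitExp α) + z 2 * unitExp α - (√2 : ℝ) / 2 * z 1‖ := by
  have h := unitExp_mul_conj α
  rw [← one_mul ‖herm _ _‖, ← norm_unitExp α, ← norm_mul, vecU_eq]
  congr 1
  simp only [herm, Matrix.cons_val, map_one, map_neg, map_mul, map_div₀, map_pow, Complex.conj_ofReal,
    Complex.conj_ofNat]
  linear_combination
    (z 0 * (starRingEnd ℂ) (unitExp α) - (√2 : ℝ) / 2 * z 1) * h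

theorem norm_herm_vecV (α : ℝ) (z : Fin 3 → ℂ) : ‖herm z (vecV α)‖ =
    ‖z 0 * unitExp α + z 2 * (starRingEnd ℂ) (unitExp α) + (√2 : ℝ) / 2 * z 1‖ := by
  have h := unitExp_mul_conj α
  rw [← one_mul ‖herm _ _‖, ← norm_unitExp α, ← norm_mul, vecV_eq, ← norm_neg]
  congr 1
  simp only [herm, Matrix.cons_val, map_one, map_neg, map_mul, map_div₀, map_pow, Complex.conj_ofReal,
    Complex.conj_ofNat]
  linear_combination
    (z 2 * (starRingEnd ℂ) (unitExp α) + (√2 : ℝ) / 2 * z 1) * h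

theorem norm_herm_vecW (α : ℝ) (z : Fin 3 → ℂ) : ‖herm z (vecW α)‖ =
    ‖z 0 - z 2 + (√2 : ℝ) / 2 * z 1 * (2 * (starRingEnd ℂ) (unitExp α) + unitExp α)‖ := by
  have h := unitExp_mul_conj α
  have h1 : ‖unitExp α ^ 2‖ = 1 := by rw [norm_pow, norm_unitExp, one_pow]
  rw [← one_mul ‖herm _ _‖, ← h1, ← norm_mul, vecW_eq]
  congr 1
  simp only [herm, Matrix.cons_val, map_neg, map_mul, map_div₀, map_pow, map_add,
    Complex.conj_ofReal, Complex.conj_ofNat]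
  generalize (starRingEnd ℂ) (unitExp α) = b at *
  generalize unitExp α = a at *
  generalize ((√2 : ℝ) : ℂ) = r at *
  have h3 : a ^ 2 * b ^ 2 = 1 := by rw [← mul_pow, h, one_pow]
  linear_combination (z 0 - z 2 + r * z 1 * b) * h3 + (r / 2 * z 1 * a) * h

theorem norm_herm_inv_vecW (α : ℝ) (z : Fin 3 → ℂ) : ‖herm z (powU α (-1) (vecW α))‖ =
    ‖z 0 - z 2 - (√2 : ℝ) / 2 * z 1 * (2 * unitExp α + (starRingEnd ℂ) (unitExp α))‖ := by
  rw [powU_neg_one_vecW, ← norm_neg]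
  congr 1
  simp only [herm, Matrix.cons_val, map_one, map_neg, map_mul, map_div₀, map_add,
    Complex.conj_ofReal, Complex.conj_ofNat, Complex.conj_conj]
  ring

/-! ### Real inequality and normalisation of representatives. -/

/-- The elementary inequality behind the theorem: coordinates are normalised by `z₁ - z₃ = 1`,
with `z₁ + z₃ = p + i q` and `z₂ = √2 i t`. -/
theorem eq_zero_of_normalised {c s p q t : ℝ} (hc : 0 < c) (hs : 0 < s) (hcs : c ^ 2 + s ^ 2 = 1)
    (hneg : p ^ 2 + q ^ 2 + 4 * t ^ 2 ≤ 1) (hle : 0 ≤ c * q * (s + t))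
    (heq : c ^ 2 * p ^ 2 + (c * q - s - t) ^ 2 = (1 + s * t) ^ 2 + 9 * c ^ 2 * t ^ 2) :
    t = 0 ∧ q = 0 ∧ p ^ 2 = 1 := by
  have hc2 : 0 < c ^ 2 := by positivity
  -- `heq` rearranged with c² + s² = 1. All three summands are nonnegative, so each vanishes.
  have h0 : c ^ 2 * (1 - (p ^ 2 + q ^ 2 + 4 * t ^ 2)) + 2 * (c * q * (s + t))
      + 12 * c ^ 2 * t ^ 2 = 0 := by
    linear_combination (-1 : ℝ) * heq - (t ^ 2 - 1) * hcs
  have h1 : 0 ≤ c ^ 2 * (1 - (p ^ 2 + q ^ 2 + 4 * t ^ 2)) := mul_nonneg hc2.le (by linarith)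
  have h2 : 0 ≤ c ^ 2 * t ^ 2 := by positivity
  have ht : t = 0 := by
    have : c ^ 2 * t ^ 2 = 0 := by linarith
    simpa [hc.ne'] using this
  subst ht
  have hq : q = 0 := by
    have : c * q * (s + 0) = 0 := by linarith
    simpa [hc.ne', hs.ne'] using this
  subst hq
  refine ⟨rfl, rfl, ?_⟩
  have : c ^ 2 * (1 - (p ^ 2 + 0 ^ 2 + 4 * 0 ^ 2)) = 0 := by linarith
  have := (mul_eq_zero.mp this).resolve_left hc2.ne'
  linarith

/-- Polarisation diagonalises the form; its only negative direction is z₁ - z₃, which therefore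
cannot vanish on a nonzero vector of nonpositive type. -/
theorem herm_self_re (z : Fin 3 → ℂ) : (herm z z).re * 2 =
    normSq (z 0 + z 2) - normSq (z 0 - z 2) + 4 * normSq ((√2 : ℝ) / 2 * z 1) := by
  have h : ((√2 : ℝ) : ℂ) / 2 = ((√2 / 2 : ℝ) : ℂ) := by push_cast; rfl
  have h2 : √2 / 2 * (√2 / 2) = 1 / 2 := by
    rw [div_mul_div_comm, Real.mul_self_sqrt (by norm_num)]; norm_num
  rw [h, map_mul, Complex.normSq_ofReal, h2]
  simp [herm, Complex.normSq_apply]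
  ring

/-- A nonzero vector of nonpositive type can be scaled so that `z₁ - z₃ = 1`. -/
theorem exists_normalised_rep (x : CP2) (hx : x ∈ closedH2C) :
    ∃ (z : Fin 3 → ℂ) (hz : z ≠ 0), x = Projectivization.mk ℂ z hz ∧ z 0 - z 2 = 1 := by
  have hre : (herm x.rep x.rep).re ≤ 0 := hx
  have hM : x.rep 0 - x.rep 2 ≠ 0 := by
    intro h0
    have h := herm_self_re x.rep
    rw [h0, map_zero] at h
    have h1 := normSq_nonneg (x.rep 0 + x.rep 2)
    have h2 := normSq_nonneg ((√2 : ℝ) / 2 * x.rep 1)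
    have h3 : x.rep 0 + x.rep 2 = 0 := normSq_eq_zero.mp (by linarith)
    have h4 : ((√2 : ℝ) : ℂ) / 2 * x.rep 1 = 0 := normSq_eq_zero.mp (by linarith)
    have h5 : x.rep 1 = 0 := by simpa using h4
    have h6 : x.rep 0 = 0 := by linear_combination (h3 + h0) / 2
    have h7 : x.rep 2 = 0 := by linear_combination (h3 - h0) / 2
    apply x.rep_nonzero
    ext i
    fin_cases i
    exacts [h6, h5, h7]
  have hz : (x.rep 0 - x.rep 2)⁻¹ • x.rep ≠ 0 := smul_ne_zero (inv_ne_zero hM) x.rep_nonzero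
  refine ⟨_, hz, ?_, ?_⟩
  · conv_lhs => rw [← x.mk_rep]
    rw [Projectivization.mk_eq_mk_iff']
    exact ⟨x.rep 0 - x.rep 2, by rw [smul_smul, mul_inv_cancel₀ hM, one_smul]⟩
  · simp only [Pi.smul_apply, smul_eq_mul]
    rw [← mul_sub, inv_mul_cancel₀ hM]

/-! ### The two points lie in both faces. -/

theorem one_le_norm_three_add {w : ℂ} (hw : ‖w‖ = 1) : 1 ≤ ‖3 + 2 * w ^ 2‖ := by
  have h := norm_sub_le (3 + 2 * w ^ 2) (2 * w ^ 2)
  rw [add_sub_cancel_right, norm_mul, norm_pow, hw] at h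
  norm_num at h
  linarith

theorem pointA_mem (α : ℝ) : pointA ∈ faceMinus α 0 ∩ faceMinus α (-1) := by
  obtain ⟨m, hm⟩ := powU_one_vecV α
  obtain ⟨n, hn⟩ := powU_neg_one_vecV α
  have h3 := one_le_norm_three_add (norm_unitExp α)
  rw [pointA]
  constructor
  · rw [mk_mem_faceMinus, powU_zero, powU_zero, zero_add, hm, vecU_eq, vecV_eq, vecW_eq]
    simpa [herm, norm_unitExp, Complex.conj_ofNat, -neg_add_rev] using h3
  · rw [mk_mem_faceMinus, neg_add_cancel, powU_zero, powU_neg_one_vecW, hn, vecU_eq, vecV_eq]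
    simp [herm, norm_unitExp]

theorem pointB_mem (α : ℝ) : pointB ∈ faceMinus α 0 ∩ faceMinus α (-1) := by
  obtain ⟨m, hm⟩ := powU_one_vecV α
  obtain ⟨n, hn⟩ := powU_neg_one_vecV α
  have h3 : 1 ≤ ‖3 + 2 * (starRingEnd ℂ) (unitExp α) ^ 2‖ :=
    one_le_norm_three_add (by rw [Complex.norm_conj, norm_unitExp])
  rw [pointB]
  constructor
  · rw [mk_mem_faceMinus, powU_zero, powU_zero, zero_add, hm, vecU_eq, vecV_eq, vecW_eq]
    simp [herm, norm_unitExp]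
  · rw [mk_mem_faceMinus, neg_add_cancel, powU_zero, powU_neg_one_vecW, hn, vecU_eq, vecV_eq]
    simpa [herm, norm_unitExp, Complex.conj_ofNat] using h3

/-! ### No other point lies in both faces. -/

theorem norm_eq_iff_normSq (z w : ℂ) : ‖z‖ = ‖w‖ ↔ normSq z = normSq w := by
  rw [Complex.normSq_eq_norm_sq, Complex.normSq_eq_norm_sq,
    sq_eq_sq₀ (norm_nonneg _) (norm_nonneg _)]

theorem norm_le_iff_normSq (z w : ℂ) : ‖z‖ ≤ ‖w‖ ↔ normSq z ≤ normSq w := by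
  rw [Complex.normSq_eq_norm_sq, Complex.normSq_eq_norm_sq,
    sq_le_sq₀ (norm_nonneg _) (norm_nonneg _)]

theorem normalised_rep_eq {α : ℝ} (hα : α ∈ Set.Ioo (0 : ℝ) (Real.pi / 2)) {z : Fin 3 → ℂ}
    (hz : z 0 - z 2 = 1) (hneg : (herm z z).re ≤ 0)
    (hW : ‖herm z (vecU α)‖ = ‖herm z (vecW α)‖)
    (hW' : ‖herm z (vecU α)‖ = ‖herm z (powU α (-1) (vecW α))‖)
    (hV : ‖herm z (vecU α)‖ ≤ ‖herm z (vecV α)‖) :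
    z = ![1, 0, 0] ∨ z = ![0, 0, -1] := by
  have hc : 0 < Real.cos α := Real.cos_pos_of_mem_Ioo ⟨by linarith [hα.1, hα.2], hα.2⟩
  have hs : 0 < Real.sin α := Real.sin_pos_of_pos_of_lt_pi hα.1 (by linarith [hα.1, hα.2])
  have hcs : Real.cos α ^ 2 + Real.sin α ^ 2 = 1 := Real.cos_sq_add_sin_sq α
  have hre := herm_self_re z
  rw [norm_herm_vecU, norm_herm_vecW, norm_eq_iff_normSq] at hW
  rw [norm_herm_vecU, norm_herm_inv_vecW, norm_eq_iff_normSq] at hW'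
  rw [norm_herm_vecU, norm_herm_vecV, norm_le_iff_normSq] at hV
  have hr : ((√2 : ℝ) : ℂ) / 2 ≠ 0 := by simp
  obtain ⟨P, hP⟩ : ∃ P, P = z 0 + z 2 := ⟨_, rfl⟩
  obtain ⟨w, hw⟩ : ∃ w, w = ((√2 : ℝ) : ℂ) / 2 * z 1 := ⟨_, rfl⟩
  have h0 : z 0 = (P + 1) / 2 := by linear_combination hz / 2 - hP / 2
  have h2 : z 2 = (P - 1) / 2 := by linear_combination - hz / 2 - hP / 2
  rw [hz, ← hw] at hW hW'
  rw [hz, ← hw, ← hP] at hre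
  rw [← hw] at hV
  rw [h0, h2, unitExp_eq] at hW hW' hV
  generalize Real.cos α = c at *
  generalize Real.sin α = s at *
  obtain ⟨p, q⟩ := P
  obtain ⟨u, t⟩ := w
  simp [Complex.normSq_apply] at hW hW' hV hre
  -- In the difference of the two bisector equations the terms in u·s·t cancel, leaving 12cu.
  have hu : u = 0 := by
    have : 12 * c * u = 0 := by linear_combination hW' - hW
    simpa [hc.ne'] using this
  subst hu
  obtain ⟨ht, hq, hp⟩ := eq_zero_of_normalised (c := c) (s := s) (p := p) (q := q) (t := t) hc hs hcs
    (by nlinarith) (by nlinarith) (by linear_combination hW)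
  subst ht hq
  have h1 : z 1 = 0 := by
    have : ((√2 : ℝ) : ℂ) / 2 * z 1 = 0 := by rw [← hw]; rfl
    exact (mul_eq_zero.mp this).resolve_left hr
  have hp' : p = 1 ∨ p = -1 := by simpa using hp
  rcases hp' with rfl | rfl
  · left
    ext i
    fin_cases i
    · change z 0 = 1
      rw [h0]; apply Complex.ext <;> simp
    · exact h1
    · change z 2 = 0
      rw [h2]; apply Complex.ext <;> simp
  · right
    ext i
    fin_cases i
    · change z 0 = 0
      rw [h0]; apply Complex.ext <;> simp
    · exact h1
    · change z 2 = -1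
      rw [h2]; apply Complex.ext <;> simp
      norm_num

end FordDeformation

theorem mainTheorem3 (α₂ : ℝ) (hα₂ : α₂ ∈ Set.Ioo (0 : ℝ) (Real.pi / 2)) :
    FordDeformation.faceMinus α₂ 0 ∩ FordDeformation.faceMinus α₂ (-1) =
      {FordDeformation.pointA, FordDeformation.pointB} := by
  apply Set.Subset.antisymm
  · rintro x ⟨hx, hx'⟩
    obtain ⟨z, hz, rfl, hz1⟩ := FordDeformation.exists_normalised_rep x hx.1.1
    rw [FordDeformation.mk_mem_faceMinus, FordDeformation.powU_zero,
      FordDeformation.powU_zero] at hx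
    rw [FordDeformation.mk_mem_faceMinus] at hx'
    rcases FordDeformation.normalised_rep_eq hα₂ hz1 hx.1.1 hx.1.2 hx'.1.2
      (hx.2.trans (min_le_left _ _)) with rfl | rfl
    · left
      rfl
    · right
      rw [Set.mem_singleton_iff, FordDeformation.pointB, Projectivization.mk_eq_mk_iff']
      -- The normalisation z₁ - z₃ = 1 represents p_B by its negative.
      exact ⟨-1, by ext i; fin_cases i <;> simp⟩
  · rintro x (rfl | rfl)
    · exact FordDeformation.pointA_mem α₂
    · exact FordDeformation.pointB_mem α₂
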